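/- **Theorem (monotonicity of the quantum Fisher information matrix).** Let $f:(0,\infty)\to(0,\infty)$ be matrix monotone, i.e. $A\le B$ implies $f(A)\le f(B)$ for all positive definite complex matrices $A,B$ of every size (for example, a standard one, which satisfies in addition $f(1)=1$ and $x f(x^{-1})=f(x)$). For $x,y>0$ put $m_f(x,y)=y f(x/y)$, extended by continuity, $m_f(x,y)=\lim_{\varepsilon\downarrow 0}m_f(x+\varepsilon,y+\varepsilon)$, if $x=0$ or $y=0$. For a positive semidefinite $D\in M_n=M_n(\mathbb C)$ let $\mathbb J^f_D:M_n\to M_n$ be the linear map which in an orthonormal eigenbasis of $D$, with eigenvalues $\lambda_1,\dots,\lambda_n$, is $(\mathbb J^f_D B)_{ij}=m_f(\lambda_i,\lambda_j)B_{ij}$; for invertible $D$ this is $\mathbb J^f_D=f(\mathbb L_D\mathbb R_D^{-1})\mathbb R_D$ with $\mathbb L_D X=DX$, $\mathbb R_D X=XD$. Let $(\mathbb J^f_D)^{-1}$ be its inverse if $D$ is invertible, and its Moore--Penrose inverse in general. For a family $\rho(\theta)$ of density matrices depending differentiably on $\theta$ in an open set $G\subset\mathbb R^k$, the $f$-quantum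 Fisher information matrix is the $k\times k$ matrix $$J(\theta)_{ij}=\mathrm{Tr}\,L_i(\theta)\,\mathbb J^f_{\rho(\theta)}\big(L_j(\theta)\big),\qquad L_i(\theta)=(\mathbb J^f_{\rho(\theta)})^{-1}\big(\partial_{\theta_i}\rho(\theta)\big).$$ Let $\beta:M_n\to M_m$ be a completely positive trace preserving linear map, and let $\rho(\theta)\in M_n$, $\theta\in G$, be a smooth family of invertible density matrices. Let $J_1(\theta)$ be the $f$-quantum Fisher information matrix of the family $\rho(\theta)$ and $J_2(\theta)$ that of the family $\beta(\rho(\theta))\in M_m$. Then for every $\theta\in G$ $$J_2(\theta)\le J_1(\theta),$$ i.e. $J_1(\theta)-J_2(\theta)$ is positive semidefinite. -/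

import Mathlib

open Matrix
open scoped Matrix.Norms.L2Operator MatrixOrder CStarAlgebra ComplexOrder ContDiff

namespace QuantumFisher

noncomputable section

/-- `f : (0, ∞) → (0, ∞)` is matrix monotone: for positive definite matrices of any size,
`A ≤ B` implies `f(A) ≤ f(B)`. Only the values of `f` on `(0, ∞)` matter. -/
structure IsMatrixMonotone (f : ℝ → ℝ) : Prop where
  pos : ∀ x : ℝ, 0 < x → 0 < f x
  mono : ∀ (d : ℕ) (A B : Matrix (Fin d) (Fin d) ℂ), A.PosDef → B.PosDef → A ≤ B →
    cfc f A ≤ cfc f B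

/-- A density matrix: positive semidefinite with trace one. -/
structure IsDensity {n : ℕ} (D : Matrix (Fin n) (Fin n) ℂ) : Prop where
  posSemidef : D.PosSemidef
  trace_eq_one : D.trace = 1

/-- The mean `m_f(x, y) = y f(x / y)` for `x, y > 0`, extended by continuity to the boundary
of the quadrant. -/
def mean (f : ℝ → ℝ) (x y : ℝ) : ℝ :=
  if 0 < x ∧ 0 < y then y * f (x / y)
  else Function.rightLim (fun ε : ℝ => (y + ε) * f ((x + ε) / (y + ε))) 0

/-- For unitary `U`: the map `B ↦ U (k ∘ (U* B U)) U*`, with `∘` the Hadamard product. -/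
def hadamardOp {n : ℕ} (U : unitary (Matrix (Fin n) (Fin n) ℂ)) (k : Fin n → Fin n → ℂ) :
    Matrix (Fin n) (Fin n) ℂ →ₗ[ℂ] Matrix (Fin n) (Fin n) ℂ where
  toFun B := (U : Matrix (Fin n) (Fin n) ℂ) *
    (Matrix.of k ⊙ (star (U : Matrix (Fin n) (Fin n) ℂ) * B * U)) *
      star (U : Matrix (Fin n) (Fin n) ℂ)
  map_add' A B := by
    simp [Matrix.mul_add, Matrix.add_mul, Matrix.hadamard_add]
  map_smul' c A := by
    simp [Matrix.hadamard_smul]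

open Classical in
/-- The operator `𝕁_D^f`: in an orthonormal eigenbasis of `D`, with eigenvalues `λ_i`, it is
`(𝕁_D^f B)_ij = m_f(λ_i, λ_j) B_ij`. By `jOp_eq` below it is `f(𝕃_D ℝ_D⁻¹) ℝ_D` for positive
definite `D`. (Junk value `0` if `D` is not Hermitian.) -/
def jOp {n : ℕ} (f : ℝ → ℝ) (D : Matrix (Fin n) (Fin n) ℂ) :
    Matrix (Fin n) (Fin n) ℂ →ₗ[ℂ] Matrix (Fin n) (Fin n) ℂ :=
  if hD : D.IsHermitian then
    hadamardOp hD.eigenvectorUnitary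
      (fun i j => ((mean f (hD.eigenvalues i) (hD.eigenvalues j) : ℝ) : ℂ))
  else 0

open Classical in
/-- The Moore-Penrose inverse `(𝕁_D^f)⁻¹`: in an orthonormal eigenbasis of `D` the entry `B_ij`
is multiplied by `1 / m_f(λ_i, λ_j)`, respectively by `0` if `m_f(λ_i, λ_j) = 0`. By
`jInv_comp_jOp` and `jOp_comp_jInv` below it is the inverse of `𝕁_D^f` for positive
definite `D`. -/
def jInv {n : ℕ} (f : ℝ → ℝ) (D : Matrix (Fin n) (Fin n) ℂ) :
    Matrix (Fin n) (Fin n) ℂ →ₗ[ℂ] Matrix (Fin n) (Fin n) ℂ :=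
  if hD : D.IsHermitian then
    hadamardOp hD.eigenvectorUnitary
      (fun i j => (((mean f (hD.eigenvalues i) (hD.eigenvalues j))⁻¹ : ℝ) : ℂ))
  else 0

/-- The partial derivative `∂_{θ_i} ρ(θ)` of a family of matrices. -/
def partialDeriv {n k : ℕ} (ρ : (Fin k → ℝ) → Matrix (Fin n) (Fin n) ℂ) (θ : Fin k → ℝ)
    (i : Fin k) : Matrix (Fin n) (Fin n) ℂ :=
  lineDeriv ℝ ρ θ (Pi.single i 1)

/-- The quantum score operators `L_i^f(θ) = (𝕁^f_{ρ(θ)})⁻¹ (∂_{θ_i} ρ(θ))`. -/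
def score {n k : ℕ} (f : ℝ → ℝ) (ρ : (Fin k → ℝ) → Matrix (Fin n) (Fin n) ℂ) (θ : Fin k → ℝ)
    (i : Fin k) : Matrix (Fin n) (Fin n) ℂ :=
  jInv f (ρ θ) (partialDeriv ρ θ i)

/-- The quantum Fisher information matrix `J(θ)_ij = Tr L_i^f(θ) 𝕁^f_{ρ(θ)}(L_j^f(θ))`. -/
def fisherMatrix {n k : ℕ} (f : ℝ → ℝ) (ρ : (Fin k → ℝ) → Matrix (Fin n) (Fin n) ℂ)
    (θ : Fin k → ℝ) : Matrix (Fin k) (Fin k) ℂ :=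
  Matrix.of fun i j => (score f ρ θ i * jOp f (ρ θ) (score f ρ θ j)).trace

/-! Consistency of `jOp` and `jInv` with the functional calculus, for positive definite `D`. -/

/-- The function `f(T)` of a linear operator `T` on `M_n`, self-adjoint for the Hilbert-Schmidt
inner product: functional calculus of its matrix in the orthonormal basis of matrix units. -/
def opFun {n : ℕ} (f : ℝ → ℝ) (T : Module.End ℂ (Matrix (Fin n) (Fin n) ℂ)) :
    Module.End ℂ (Matrix (Fin n) (Fin n) ℂ) :=
  (LinearMap.toMatrixAlgEquiv (Matrix.stdBasis ℂ (Fin n) (Fin n))).symm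
    (cfc f (LinearMap.toMatrixAlgEquiv (Matrix.stdBasis ℂ (Fin n) (Fin n)) T))

theorem hadamardOp_comp {n : ℕ} (U : unitary (Matrix (Fin n) (Fin n) ℂ))
    (k l : Fin n → Fin n → ℂ) :
    hadamardOp U (k * l) = hadamardOp U k ∘ₗ hadamardOp U l := by
  ext1 B
  have h : star (U : Matrix (Fin n) (Fin n) ℂ) * U = 1 := Unitary.coe_star_mul_self U
  have h2 : ∀ X : Matrix (Fin n) (Fin n) ℂ,
      star (U : Matrix (Fin n) (Fin n) ℂ) * (U * X * star (U : Matrix (Fin n) (Fin n) ℂ)) * U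
        = X := by
    intro X
    calc _ = (star (U : Matrix (Fin n) (Fin n) ℂ) * U) * X *
        (star (U : Matrix (Fin n) (Fin n) ℂ) * U) := by simp only [Matrix.mul_assoc]
      _ = X := by rw [h]; simp
  simp only [hadamardOp, LinearMap.coe_comp, Function.comp_apply, LinearMap.coe_mk,
    AddHom.coe_mk, h2]
  congr 2
  ext i j
  simp [Matrix.hadamard, mul_assoc]

theorem hadamardOp_one {n : ℕ} (U : unitary (Matrix (Fin n) (Fin n) ℂ)) :
    hadamardOp U 1 = LinearMap.id := by
  ext1 B
  have h : (U : Matrix (Fin n) (Fin n) ℂ) * star (U : Matrix (Fin n) (Fin n) ℂ) = 1 :=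
    Unitary.coe_mul_star_self U
  have h1 : ∀ X : Matrix (Fin n) (Fin n) ℂ,
      Matrix.of (1 : Fin n → Fin n → ℂ) ⊙ X = X := by
    intro X; ext i j; simp [Matrix.hadamard]
  simp only [hadamardOp, LinearMap.coe_mk, AddHom.coe_mk, h1, LinearMap.id_apply]
  calc _ = ((U : Matrix (Fin n) (Fin n) ℂ) * star (U : Matrix (Fin n) (Fin n) ℂ)) * B *
        ((U : Matrix (Fin n) (Fin n) ℂ) * star (U : Matrix (Fin n) (Fin n) ℂ)) := by
          simp only [Matrix.mul_assoc]
    _ = B := by rw [h]; simp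

theorem mean_pos {f : ℝ → ℝ} (hf : ∀ x : ℝ, 0 < x → 0 < f x) {x y : ℝ} (hx : 0 < x)
    (hy : 0 < y) : 0 < mean f x y := by
  rw [mean, if_pos ⟨hx, hy⟩]
  exact mul_pos hy (hf _ (div_pos hx hy))

theorem jInv_comp_jOp {n : ℕ} {f : ℝ → ℝ} (hf : ∀ x : ℝ, 0 < x → 0 < f x)
    {D : Matrix (Fin n) (Fin n) ℂ} (hD : D.PosDef) :
    jInv f D ∘ₗ jOp f D = LinearMap.id := by
  rw [jInv, jOp, dif_pos hD.1, dif_pos hD.1, ← hadamardOp_comp, ← hadamardOp_one]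
  congr 1
  funext i j
  have := (mean_pos hf (hD.eigenvalues_pos i) (hD.eigenvalues_pos j)).ne'
  simp [this]

theorem jOp_comp_jInv {n : ℕ} {f : ℝ → ℝ} (hf : ∀ x : ℝ, 0 < x → 0 < f x)
    {D : Matrix (Fin n) (Fin n) ℂ} (hD : D.PosDef) :
    jOp f D ∘ₗ jInv f D = LinearMap.id := by
  rw [jInv, jOp, dif_pos hD.1, dif_pos hD.1, ← hadamardOp_comp, ← hadamardOp_one]
  congr 1
  funext i j
  have := (mean_pos hf (hD.eigenvalues_pos i) (hD.eigenvalues_pos j)).ne'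
  simp [this]

/-- `k ↦ hadamardOp U k` as a homomorphism of algebras. -/
def hadamardHom {n : ℕ} (U : unitary (Matrix (Fin n) (Fin n) ℂ)) :
    (Fin n → Fin n → ℂ) →ₐ[ℂ] Module.End ℂ (Matrix (Fin n) (Fin n) ℂ) :=
  AlgHom.ofLinearMap
    { toFun := hadamardOp U
      map_add' := fun k l => by
        ext1 B
        have : Matrix.of (k + l) = Matrix.of k + Matrix.of l := rfl
        simp only [hadamardOp, this, Matrix.add_hadamard, Matrix.mul_add, Matrix.add_mul,
          LinearMap.coe_mk, AddHom.coe_mk, LinearMap.add_apply]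
      map_smul' := fun c k => by
        ext1 B
        have : Matrix.of (c • k) = c • Matrix.of k := rfl
        simp only [hadamardOp, this, Matrix.smul_hadamard, Matrix.mul_smul, Matrix.smul_mul,
          LinearMap.coe_mk, AddHom.coe_mk, LinearMap.smul_apply, RingHom.id_apply] }
    (hadamardOp_one U) (fun k l => hadamardOp_comp U k l)

theorem mulLeft_eq {n : ℕ} {D : Matrix (Fin n) (Fin n) ℂ} (hD : D.IsHermitian) :
    LinearMap.mulLeft ℂ D =
      hadamardOp hD.eigenvectorUnitary (fun i _ => (hD.eigenvalues i : ℂ)) := by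
  ext1 B
  have h : (hD.eigenvectorUnitary : Matrix (Fin n) (Fin n) ℂ) *
      star (hD.eigenvectorUnitary : Matrix (Fin n) (Fin n) ℂ) = 1 :=
    Unitary.coe_mul_star_self _
  have hs : (hD.eigenvectorUnitary : Matrix (Fin n) (Fin n) ℂ) *
      diagonal (fun i => (hD.eigenvalues i : ℂ)) *
      star (hD.eigenvectorUnitary : Matrix (Fin n) (Fin n) ℂ) = D := hD.spectral_theorem.symm
  have h1 : ∀ X : Matrix (Fin n) (Fin n) ℂ,
      Matrix.of (fun i (_ : Fin n) => (hD.eigenvalues i : ℂ)) ⊙ X =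
        diagonal (fun i => (hD.eigenvalues i : ℂ)) * X := by
    intro X; ext i j; simp [Matrix.hadamard]
  simp only [hadamardOp, LinearMap.coe_mk, AddHom.coe_mk, LinearMap.mulLeft_apply]
  rw [h1]
  generalize (hD.eigenvectorUnitary : Matrix (Fin n) (Fin n) ℂ) = V at h hs
  generalize diagonal (fun i => (hD.eigenvalues i : ℂ)) = L at hs
  calc D * B = (V * L * star V) * B * (V * star V) := by rw [hs, h, Matrix.mul_one]
    _ = V * (L * (star V * B * V)) * star V := by simp only [Matrix.mul_assoc]

theorem mulRight_eq {n : ℕ} {D : Matrix (Fin n) (Fin n) ℂ} (hD : D.IsHermitian) :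
    LinearMap.mulRight ℂ D =
      hadamardOp hD.eigenvectorUnitary (fun _ j => (hD.eigenvalues j : ℂ)) := by
  ext1 B
  have h : (hD.eigenvectorUnitary : Matrix (Fin n) (Fin n) ℂ) *
      star (hD.eigenvectorUnitary : Matrix (Fin n) (Fin n) ℂ) = 1 :=
    Unitary.coe_mul_star_self _
  have hs : (hD.eigenvectorUnitary : Matrix (Fin n) (Fin n) ℂ) *
      diagonal (fun i => (hD.eigenvalues i : ℂ)) *
      star (hD.eigenvectorUnitary : Matrix (Fin n) (Fin n) ℂ) = D := hD.spectral_theorem.symm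
  have h1 : ∀ X : Matrix (Fin n) (Fin n) ℂ,
      Matrix.of (fun (_ : Fin n) j => (hD.eigenvalues j : ℂ)) ⊙ X =
        X * diagonal (fun i => (hD.eigenvalues i : ℂ)) := by
    intro X; ext i j; simp [Matrix.hadamard, mul_comm]
  simp only [hadamardOp, LinearMap.coe_mk, AddHom.coe_mk, LinearMap.mulRight_apply]
  rw [h1]
  generalize (hD.eigenvectorUnitary : Matrix (Fin n) (Fin n) ℂ) = V at h hs
  generalize diagonal (fun i => (hD.eigenvalues i : ℂ)) = L at hs
  calc B * D = (V * star V) * B * (V * L * star V) := by rw [hs, h, Matrix.one_mul]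
    _ = V * ((star V * B * V) * L) * star V := by simp only [Matrix.mul_assoc]

theorem mulRight_inv_eq {n : ℕ} {D : Matrix (Fin n) (Fin n) ℂ} (hD : D.PosDef) :
    LinearMap.mulRight ℂ D⁻¹ =
      hadamardOp hD.1.eigenvectorUnitary (fun _ j => ((hD.1.eigenvalues j)⁻¹ : ℂ)) := by
  have h1 : LinearMap.mulRight ℂ D⁻¹ ∘ₗ LinearMap.mulRight ℂ D = LinearMap.id := by
    ext1 B
    have : D * D⁻¹ = 1 := Matrix.mul_nonsing_inv D ((Matrix.isUnit_iff_isUnit_det D).1 hD.isUnit)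
    simp [Matrix.mul_assoc, this]
  have h2 : hadamardOp hD.1.eigenvectorUnitary (fun _ j => (hD.1.eigenvalues j : ℂ)) ∘ₗ
      hadamardOp hD.1.eigenvectorUnitary (fun _ j => ((hD.1.eigenvalues j)⁻¹ : ℂ)) =
        LinearMap.id := by
    rw [← hadamardOp_comp, ← hadamardOp_one]
    congr 1
    funext i j
    have := (hD.eigenvalues_pos j).ne'
    simp [this]
  rw [mulRight_eq hD.1] at h1
  calc LinearMap.mulRight ℂ D⁻¹ = LinearMap.mulRight ℂ D⁻¹ ∘ₗ
        (hadamardOp hD.1.eigenvectorUnitary (fun _ j => (hD.1.eigenvalues j : ℂ)) ∘ₗ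
      hadamardOp hD.1.eigenvectorUnitary (fun _ j => ((hD.1.eigenvalues j)⁻¹ : ℂ))) := by
          rw [h2, LinearMap.comp_id]
    _ = _ := by rw [← LinearMap.comp_assoc, h1, LinearMap.id_comp]

theorem opFun_eq {n : ℕ} (f : ℝ → ℝ) (U : unitary (Matrix (Fin n) (Fin n) ℂ))
    (r : Fin n → Fin n → ℝ) (T : Module.End ℂ (Matrix (Fin n) (Fin n) ℂ))
    (hT : T = hadamardOp U (fun i j => (r i j : ℂ)))
    (hsa : IsSelfAdjoint
      (LinearMap.toMatrixAlgEquiv (Matrix.stdBasis ℂ (Fin n) (Fin n)) T)) :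
    opFun f T = hadamardOp U (fun i j => (f (r i j) : ℂ)) := by
  classical
  set A := LinearMap.toMatrixAlgEquiv (Matrix.stdBasis ℂ (Fin n) (Fin n)) T with hA
  have hfin : (spectrum ℝ A).Finite := Matrix.finite_real_spectrum
  set S : Finset ℝ := hfin.toFinset ∪ Finset.univ.image (fun x : Fin n × Fin n => r x.1 x.2)
    with hS
  set p : Polynomial ℝ := Lagrange.interpolate S id f with hp
  have hpe : ∀ x ∈ S, p.eval x = f x := fun x hx =>
    Lagrange.eval_interpolate_at_node f (Function.injective_id.injOn) hx
  have h1 : cfc f A = Polynomial.aeval A p := by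
    rw [← cfc_polynomial p A hsa]
    refine cfc_congr fun x hx => ?_
    exact (hpe x (by simp [hS, hx])).symm
  have h2 : Polynomial.aeval A p =
      LinearMap.toMatrixAlgEquiv (Matrix.stdBasis ℂ (Fin n) (Fin n))
        (hadamardOp U (fun i j => (f (r i j) : ℂ))) := by
    have e : A = (((LinearMap.toMatrixAlgEquiv
        (Matrix.stdBasis ℂ (Fin n) (Fin n))).toAlgHom.comp (hadamardHom U)).restrictScalars ℝ)
          (fun i j => (r i j : ℂ)) := by
      rw [hA, hT]; rfl
    rw [e, Polynomial.aeval_algHom_apply]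
    have : Polynomial.aeval (fun i j => (r i j : ℂ)) p =
        (fun i j => (f (r i j) : ℂ) : Fin n → Fin n → ℂ) := by
      funext i j
      have e1 : (Polynomial.aeval (fun i j => (r i j : ℂ)) p : Fin n → Fin n → ℂ) i j =
          Polynomial.aeval ((r i j : ℝ) : ℂ) p :=
        (Polynomial.aeval_algHom_apply
          ((Pi.evalAlgHom ℝ (fun _ : Fin n => ℂ) j).comp
            (Pi.evalAlgHom ℝ (fun _ : Fin n => Fin n → ℂ) i))
          (fun i j => (r i j : ℂ)) p).symm
      rw [e1, ← hpe (r i j) (by simp only [hS, Finset.mem_union, Finset.mem_image]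
                                exact Or.inr ⟨(i, j), Finset.mem_univ _, rfl⟩)]
      exact Polynomial.aeval_algebraMap_apply_eq_algebraMap_eval (r i j) p
    rw [this]; rfl
  rw [opFun, ← hA, h1, h2, AlgEquiv.symm_apply_apply]

/-- For positive definite `D`, `jOp f D` is `f(𝕃_D ℝ_D⁻¹) ℝ_D`, where `𝕃_D X = D X` and
`ℝ_D X = X D`. -/
theorem jOp_eq {n : ℕ} (f : ℝ → ℝ) {D : Matrix (Fin n) (Fin n) ℂ} (hD : D.PosDef) :
    jOp f D = opFun f (LinearMap.mulLeft ℂ D ∘ₗ LinearMap.mulRight ℂ D⁻¹) ∘ₗ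
      LinearMap.mulRight ℂ D := by
  have hT : LinearMap.mulLeft ℂ D ∘ₗ LinearMap.mulRight ℂ D⁻¹ =
      hadamardOp hD.1.eigenvectorUnitary
        (fun i j => ((hD.1.eigenvalues i / hD.1.eigenvalues j : ℝ) : ℂ)) := by
    rw [mulLeft_eq hD.1, mulRight_inv_eq hD, ← hadamardOp_comp]
    congr 1
    funext i j
    simp [div_eq_mul_inv]
  have hsa : IsSelfAdjoint (LinearMap.toMatrixAlgEquiv (Matrix.stdBasis ℂ (Fin n) (Fin n))
      (LinearMap.mulLeft ℂ D ∘ₗ LinearMap.mulRight ℂ D⁻¹)) := by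
    have hi : (D⁻¹).IsHermitian := hD.1.inv
    have he : ∀ x y : Fin n × Fin n,
        LinearMap.toMatrixAlgEquiv (Matrix.stdBasis ℂ (Fin n) (Fin n))
          (LinearMap.mulLeft ℂ D ∘ₗ LinearMap.mulRight ℂ D⁻¹) x y =
          D x.1 y.1 * D⁻¹ y.2 x.2 := by
      rintro ⟨i, j⟩ ⟨a, b⟩
      rw [LinearMap.toMatrixAlgEquiv_apply, Matrix.stdBasis_eq_single]
      have : ∀ X : Matrix (Fin n) (Fin n) ℂ,
          (Matrix.stdBasis ℂ (Fin n) (Fin n)).repr X (i, j) = X i j := fun X => rfl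
      rw [this]
      simp only [LinearMap.coe_comp, Function.comp_apply, LinearMap.mulLeft_apply,
        LinearMap.mulRight_apply]
      rw [← Matrix.mul_assoc, Matrix.mul_apply, Finset.sum_eq_single b]
      · simp
      · intro c _ hc
        simp [hc]
      · simp
    change star _ = _
    ext x y
    rw [Matrix.star_apply, he, he, star_mul', hD.1.apply, hi.apply]
  rw [opFun_eq f _ _ _ hT hsa, mulRight_eq hD.1, ← hadamardOp_comp, jOp, dif_pos hD.1]
  congr 1
  funext i j
  simp [mean, hD.eigenvalues_pos i, hD.eigenvalues_pos j, mul_comm]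

end

end QuantumFisher

/-!
Write `φ` for the channel `β` in eigenbases of `D = ρ(θ)` and `D' = β(ρ(θ))`, and `φ*` for its
Hilbert-Schmidt adjoint. In these bases the Fisher information matrix is a Gram matrix of the
partial derivatives of the family, for the form whose weights are the reciprocals of the means
`m_f(λ_b, λ_a)` (`fisherMatrix_eq`), and the partial derivatives of `β ∘ ρ` are the images under `φ`
of those of `ρ`. So it suffices to prove `φ* (𝕁_{D'})⁻¹ φ ≤ (𝕁_D)⁻¹`.

Two-positivity of `φ` and preservation of the trace give `φ ℝ_D φ* ≤ ℝ_{D'}` and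
`φ 𝕃_D φ* ≤ 𝕃_{D'}` (`adjointMatrix_mul_snd_le`, `adjointMatrix_mul_fst_le`). Only diagonal matrices
occur here, with entries `λ_b` and `λ_a`. A matrix monotone `f` satisfies Hansen's inequality
`Vᴴ f(A) V ≤ f(Vᴴ A V)` for contractions `V` (`IsMatrixMonotone.contraction_le`), obtained by
dilating `V` to an isometry and comparing `A` with a matrix that is block diagonal with respect to
the range of the isometry (`IsMatrixMonotone.compress_le`); neither continuity nor an integral
representation of `f` is needed. After rescaling, Hansen's inequality says that the two bounds above
imply the same bound for the means, that is `φ 𝕁_D φ* ≤ 𝕁_{D'}` (`IsMatrixMonotone.mean_le`). Taking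
the two Schur complements of a block matrix turns this into `φ* (𝕁_{D'})⁻¹ φ ≤ (𝕁_D)⁻¹`
(`mul_diagonal_inv_mul_le`).

The matrix `D'` may be singular. The bounds for `ℝ_D` and `𝕃_D` show that the range of `φ` is then
supported on the support of `D'`, so that the boundary values of the mean play no role
(`eq_zero_of_conjTranspose_mul_diagonal_mul_le`, `IsMatrixMonotone.inv_mean_le`).
-/

namespace QuantumFisher

/-! ### Functional calculus and compression by an isometry -/

section MatrixMonotone

variable {ι κ : Type*} [Fintype ι] [DecidableEq ι] [Fintype κ] [DecidableEq κ]

/-- Intertwining passes to the functional calculus, since `f` agrees with a polynomial on a finite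
set containing both spectra. The matrix `W` need not be square, which makes it possible to evaluate
`cfc f A` on an invariant subspace. -/
theorem cfc_mul_of_mul_eq (f : ℝ → ℝ) {d : ℕ} {A : Matrix (Fin d) (Fin d) ℂ}
    (hA : A.IsHermitian) (W : Matrix (Fin d) ι ℂ) (s : ι → ℝ)
    (h : A * W = W * diagonal (fun i => (s i : ℂ))) :
    cfc f A * W = W * diagonal (fun i => (f (s i) : ℂ)) := by
  classical
  have hfin : (spectrum ℝ A).Finite := Matrix.finite_real_spectrum
  set S : Finset ℝ := hfin.toFinset ∪ Finset.univ.image s with hS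
  set p : Polynomial ℝ := Lagrange.interpolate S id f with hp
  have hpe : ∀ x ∈ S, p.eval x = f x := fun x hx =>
    Lagrange.eval_interpolate_at_node f (Function.injective_id.injOn) hx
  have h1 : cfc f A = Polynomial.aeval A p := by
    rw [← cfc_polynomial p A hA]
    exact cfc_congr fun x hx => (hpe x (by simp [hS, hx])).symm
  have h2 : ∀ q : Polynomial ℝ, Polynomial.aeval A q * W =
      W * diagonal (fun i => ((q.eval (s i) : ℝ) : ℂ)) := by
    intro q
    induction q using Polynomial.induction_on' with
    | add q₁ q₂ h₁ h₂ =>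
      rw [map_add, Matrix.add_mul, h₁, h₂, ← Matrix.mul_add, diagonal_add]
      simp
    | monomial k c =>
      have hk : A ^ k * W = W * diagonal (fun i => ((s i ^ k : ℝ) : ℂ)) := by
        induction k with
        | zero => simp
        | succ k ih =>
          rw [pow_succ, Matrix.mul_assoc, h, ← Matrix.mul_assoc, ih, Matrix.mul_assoc,
            diagonal_mul_diagonal]
          simp [pow_succ]
      rw [Polynomial.aeval_monomial, Algebra.algebraMap_eq_smul_one, smul_mul_assoc, one_mul,
        Matrix.smul_mul, hk, ← Matrix.mul_smul]
      congr 1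
      ext i j
      by_cases hij : i = j
      · subst hij; simp
      · simp [hij]
  rw [h1, h2]
  congr 2
  funext i
  rw [hpe (s i) (by simp [hS])]

theorem cfc_diagonal (f : ℝ → ℝ) {d : ℕ} (r : Fin d → ℝ) :
    cfc f (diagonal (fun i => (r i : ℂ))) = diagonal (fun i => (f (r i) : ℂ)) := by
  have hr : (diagonal (fun i => (r i : ℂ))).IsHermitian :=
    isHermitian_diagonal_of_self_adjoint _ (by ext i; simp)
  simpa using cfc_mul_of_mul_eq f hr 1 r (by simp)

theorem conjTranspose_mul_mul_le {ι κ : Type*} [Fintype ι] [Fintype κ] {A B : Matrix ι ι ℂ}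
    (h : A ≤ B) (W : Matrix ι κ ℂ) :
    Wᴴ * A * W ≤ Wᴴ * B * W := by
  rw [Matrix.le_iff] at h ⊢
  have := h.conjTranspose_mul_mul_same W
  rwa [Matrix.mul_sub, Matrix.sub_mul] at this

theorem diagonal_le_diagonal {ι : Type*} [DecidableEq ι] {r s : ι → ℝ} (h : ∀ i, r i ≤ s i) :
    diagonal (fun i => (r i : ℂ)) ≤ diagonal (fun i => (s i : ℂ)) := by
  rw [Matrix.le_iff, diagonal_sub, posSemidef_diagonal_iff]
  intro i
  rw [← Complex.ofReal_sub]
  exact Complex.zero_le_real.2 (sub_nonneg.2 (h i))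

/-- Compression of a matrix monotone function to the range of an isometry `W`, with a margin
`t > 0`. With `P = W Wᴴ`, `Q = 1 - P`, the matrix `diagonal r` is dominated by a matrix that is
block diagonal with respect to `P` and `Q`, acts as `diagonal s` on the range of `P`, and is a
large multiple of the identity on the range of `Q`. -/
theorem IsMatrixMonotone.compress_le {f : ℝ → ℝ} (hf : IsMatrixMonotone f) {d : ℕ}
    {r : Fin d → ℝ} {s : ι → ℝ} (hr : ∀ i, 0 < r i) {W : Matrix (Fin d) ι ℂ}
    (hW : Wᴴ * W = 1) {t : ℝ} (ht : 0 < t)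
    (h : (1 + t) • (Wᴴ * diagonal (fun i => (r i : ℂ)) * W) ≤ diagonal (fun i => (s i : ℂ))) :
    Wᴴ * diagonal (fun i => (f (r i) : ℂ)) * W ≤ diagonal (fun i => (f (s i) : ℂ)) := by
  obtain ⟨b, hb⟩ : ∃ b : ℝ, ∀ i, r i ≤ b :=
    ⟨∑ i, r i, fun i => Finset.single_le_sum (fun j _ => (hr j).le) (Finset.mem_univ i)⟩
  set B : Matrix (Fin d) (Fin d) ℂ := diagonal (fun i => (r i : ℂ)) with hB
  set X : Matrix ι ι ℂ := diagonal (fun i => (s i : ℂ)) with hX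
  set P : Matrix (Fin d) (Fin d) ℂ := W * Wᴴ with hP
  set Q : Matrix (Fin d) (Fin d) ℂ := 1 - P with hQ
  have hPh : Pᴴ = P := by simp [hP]
  have hQh : Qᴴ = Q := by simp [hQ, hPh]
  have hPP : P * P = P := by
    rw [hP, Matrix.mul_assoc, ← Matrix.mul_assoc Wᴴ, hW, Matrix.one_mul]
  have hQQ : Q * Q = Q := by
    rw [hQ, Matrix.mul_sub, Matrix.sub_mul, Matrix.sub_mul, hPP]; simp
  have hBpos : B.PosDef := PosDef.diagonal fun i => by simpa using hr i
  set C : Matrix (Fin d) (Fin d) ℂ := W * X * Wᴴ + ((1 + t⁻¹) * b) • Q with hC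
  have hCB : (C - B).PosSemidef := by
    have h1 : (W * (X - (1 + t) • (Wᴴ * B * W)) * Wᴴ).PosSemidef :=
      (Matrix.le_iff.1 h).mul_mul_conjTranspose_same W
    have h2 : ((1 + t⁻¹) • (Q * (b • 1 - B) * Q)).PosSemidef := by
      refine PosSemidef.smul ?_ (by positivity)
      have h3 : (b • (1 : Matrix (Fin d) (Fin d) ℂ) - B).PosSemidef := by
        have hb1 : b • (1 : Matrix (Fin d) (Fin d) ℂ) = diagonal (fun _ => (b : ℂ)) := by
          ext i j
          simp [Matrix.one_apply, diagonal_apply]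
        rw [hb1]
        exact Matrix.le_iff.1 (diagonal_le_diagonal (r := r) (s := fun _ => b) hb)
      have := h3.mul_mul_conjTranspose_same Q
      rwa [hQh] at this
    have h3 : (t⁻¹ • ((t • P - Q) * B * (t • P - Q))).PosSemidef := by
      refine PosSemidef.smul ?_ (by positivity)
      have := hBpos.posSemidef.mul_mul_conjTranspose_same (t • P - Q)
      rwa [conjTranspose_sub, conjTranspose_smul, hPh, hQh, star_trivial] at this
    -- `h3` bounds the mixed terms: `P B Q + Q B P ≤ t P B P + t⁻¹ Q B Q`.
    convert (h1.add h2).add h3 using 1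
    have e1 : W * (X - (1 + t) • (Wᴴ * B * W)) * Wᴴ = W * X * Wᴴ - (1 + t) • (P * B * P) := by
      simp only [hP, Matrix.mul_sub, Matrix.sub_mul, Matrix.mul_smul, Matrix.smul_mul,
        Matrix.mul_assoc]
    have e2 : Q * (b • 1 - B) * Q = b • Q - Q * B * Q := by
      simp [Matrix.mul_sub, Matrix.sub_mul, hQQ]
    have e3 : B = P * B * P + P * B * Q + Q * B * P + Q * B * Q := by
      simp only [hQ]; noncomm_ring
    have e4 : (t • P - Q) * B * (t • P - Q) =
        (t * t) • (P * B * P) - t • (P * B * Q) - t • (Q * B * P) + Q * B * Q := by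
      simp only [Matrix.mul_sub, Matrix.sub_mul, Matrix.smul_mul, Matrix.mul_smul]
      module
    rw [e1, e2, e4, hC]
    nth_rewrite 1 [e3]
    generalize P * B * P = M₁
    generalize P * B * Q = M₂
    generalize Q * B * P = M₃
    generalize Q * B * Q = M₄
    generalize W * X * Wᴴ = M₅
    match_scalars <;> field_simp <;> ring
  have hCpos : C.PosDef := by
    have := hBpos.add_posSemidef hCB
    rwa [add_sub_cancel] at this
  have hCW : C * W = W * X := by
    have : Q * W = 0 := by
      rw [hQ, Matrix.sub_mul, hP, Matrix.mul_assoc, hW]; simp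
    rw [hC, Matrix.add_mul, Matrix.smul_mul, this, Matrix.mul_assoc, hW]; simp
  have hm := conjTranspose_mul_mul_le
    (hf.mono d B C hBpos hCpos (Matrix.le_iff.2 hCB)) W
  rw [Matrix.mul_assoc Wᴴ (cfc f C), cfc_mul_of_mul_eq f hCpos.1 W s hCW, ← Matrix.mul_assoc, hW,
    Matrix.one_mul, hB, cfc_diagonal] at hm
  exact hm

end MatrixMonotone

/-! ### Hansen's inequality and monotonicity of the means -/

section Interpolation

variable {ι κ : Type*} [Fintype ι] [DecidableEq ι] [Fintype κ] [DecidableEq κ]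

theorem posSemidef_exists_eq_conjTranspose_mul_self {A : Matrix κ κ ℂ} (hA : A.PosSemidef) :
    ∃ Z : Matrix κ κ ℂ, A = Zᴴ * Z :=
  CStarAlgebra.nonneg_iff_eq_star_mul_self.1 hA.nonneg

theorem conjTranspose_mul_diagonal_mul_apply {ι κ : Type*} [Fintype ι] [DecidableEq ι]
    (M : Matrix ι κ ℂ) (g : ι → ℂ) (i j : κ) :
    (Mᴴ * diagonal g * M) i j = ∑ a, star (M a i) * g a * M a j := by
  rw [Matrix.mul_apply]
  simp only [Matrix.mul_diagonal, conjTranspose_apply]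

/-- Hansen's inequality `Vᴴ f(A) V ≤ f(Vᴴ A V)` for a contraction `V`, in the form where
`A = diagonal r` and `Vᴴ A V` is replaced by the upper bound `diagonal s`. The matrix `√c V` with
`c < 1` is dilated to an isometry; the gap `1 - c` provides the margin needed for the compression
inequality and, at the end, `c` tends to `1`. -/
theorem IsMatrixMonotone.contraction_le {f : ℝ → ℝ} (hf : IsMatrixMonotone f)
    {r : ι → ℝ} {s : κ → ℝ} (hr : ∀ i, 0 < r i) (hs : ∀ i, 0 < s i) {V : Matrix ι κ ℂ}
    (hV : Vᴴ * V ≤ 1)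
    (h : Vᴴ * diagonal (fun i => (r i : ℂ)) * V ≤ diagonal (fun i => (s i : ℂ))) :
    Vᴴ * diagonal (fun i => (f (r i) : ℂ)) * V ≤ diagonal (fun i => (f (s i) : ℂ)) := by
  obtain ⟨b, hb0, hb⟩ : ∃ b : ℝ, 0 < b ∧ ∀ i, b ≤ s i := by
    rcases isEmpty_or_nonempty κ with hκ | hκ
    · exact ⟨1, one_pos, fun i => isEmptyElim i⟩
    · obtain ⟨i₀, h₀⟩ := Finite.exists_min s
      exact ⟨s i₀, hs i₀, h₀⟩
  have key : ∀ c : ℝ, 0 < c → c < 1 →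
      c • (Vᴴ * diagonal (fun i => (f (r i) : ℂ)) * V) ≤ diagonal (fun i => (f (s i) : ℂ)) := by
    intro c hc0 hc1
    have hVV : (1 - Vᴴ * V).PosSemidef := Matrix.le_iff.1 hV
    have hZ : (1 - c • (Vᴴ * V)).PosSemidef := by
      have := (hVV.smul hc0.le).add (PosSemidef.one.smul (sub_nonneg.2 hc1.le))
      convert this using 1
      module
    obtain ⟨Z, hZ⟩ := posSemidef_exists_eq_conjTranspose_mul_self hZ
    -- The value `δ` on the added summand is small enough for the margin `t = (1 - c) / (1 + c)`.
    set δ : ℝ := b * (1 - c) / 2 with hδ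
    have hδ0 : 0 < δ := by have := sub_pos.2 hc1; positivity
    have hcc : ((√c : ℝ) : ℝ) * √c = c := Real.mul_self_sqrt hc0.le
    let e : Fin (Fintype.card (ι ⊕ κ)) ≃ ι ⊕ κ := (Fintype.equivFin (ι ⊕ κ)).symm
    let W : Matrix (Fin (Fintype.card (ι ⊕ κ))) κ ℂ := (fromRows (√c • V) Z).submatrix e id
    have hW : ∀ g : ι ⊕ κ → ℝ, Wᴴ * diagonal (fun a => (g (e a) : ℂ)) * W =
        c • (Vᴴ * diagonal (fun i => (g (Sum.inl i) : ℂ)) * V) +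
          Zᴴ * diagonal (fun i => (g (Sum.inr i) : ℂ)) * Z := by
      intro g
      ext i j
      rw [Matrix.add_apply, Matrix.smul_apply]
      simp only [conjTranspose_mul_diagonal_mul_apply, W, submatrix_apply, id]
      rw [e.sum_comp (fun a => star (fromRows (√c • V) Z a i) * (g a : ℂ) *
        fromRows (√c • V) Z a j), Fintype.sum_sum_type]
      simp only [Matrix.smul_apply, fromRows_apply_inl, fromRows_apply_inr, Finset.smul_sum]
      congr 1
      refine Finset.sum_congr rfl fun a _ => ?_
      rw [star_smul, star_trivial, smul_mul_assoc, smul_mul_smul_comm, hcc]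
    have hW1 : Wᴴ * W = 1 := by
      have := hW (fun _ => 1)
      simp only [Complex.ofReal_one, diagonal_one, Matrix.mul_one] at this
      rw [this, ← hZ]
      abel
    have h1c : 0 < 1 + c := by positivity
    have h1c' : 0 < 1 - c := sub_pos.2 hc1
    have hm := hf.compress_le (r := fun a => Sum.elim r (fun _ => δ) (e a)) (s := s)
      (fun a => by
        rcases e a with i | i
        · exact hr i
        · exact hδ0)
      hW1 (t := (1 - c) / (1 + c)) (by positivity) (by
        rw [hW]
        simp only [Sum.elim_inl, Sum.elim_inr]
        have hd : diagonal (fun _ : κ => (δ : ℂ)) = δ • (1 : Matrix κ κ ℂ) := by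
          ext i j
          simp [Matrix.one_apply, diagonal_apply]
        rw [hd, Matrix.mul_smul, Matrix.mul_one, Matrix.smul_mul, ← hZ]
        have h2 := Matrix.le_iff.1 h
        have h3 := Matrix.le_iff.1 (diagonal_le_diagonal hb)
        have hd' : diagonal (fun _ : κ => (b : ℂ)) = b • (1 : Matrix κ κ ℂ) := by
          ext i j
          simp [Matrix.one_apply, diagonal_apply]
        rw [hd'] at h3
        rw [Matrix.le_iff]
        have p2 : 0 ≤ 2 * c / (1 + c) := by positivity
        have p3 : 0 ≤ (1 - c) / (1 + c) := by positivity
        have p4 : 0 ≤ 2 * c * δ / (1 + c) := by positivity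
        have := ((h2.smul p2).add (h3.smul p3)).add
          ((posSemidef_conjTranspose_mul_self V).smul p4)
        convert this using 1
        rw [hδ]
        match_scalars <;> field_simp <;> ring)
    rw [hW (fun a => f (Sum.elim r (fun _ => δ) a))] at hm
    refine le_trans ?_ hm
    simp only [Sum.elim_inl, Sum.elim_inr]
    rw [Matrix.le_iff, add_sub_cancel_left]
    exact (PosSemidef.diagonal fun i => by
      simpa using (hf.pos δ hδ0).le).conjTranspose_mul_mul_same Z
  have ht : Filter.Tendsto
      (fun c : ℝ => c • (Vᴴ * diagonal (fun i => (f (r i) : ℂ)) * V)) (nhdsWithin 1 (Set.Iio 1))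
      (nhds (Vᴴ * diagonal (fun i => (f (r i) : ℂ)) * V)) := by
    have : Continuous fun c : ℝ => c • (Vᴴ * diagonal (fun i => (f (r i) : ℂ)) * V) := by
      fun_prop
    have := this.tendsto 1
    rw [one_smul] at this
    exact this.mono_left nhdsWithin_le_nhds
  refine le_of_tendsto ht ?_
  filter_upwards [Ioo_mem_nhdsLT (zero_lt_one' ℝ)] with c hc using key c hc.1 hc.2

theorem mean_of_pos (f : ℝ → ℝ) {x y : ℝ} (hx : 0 < x) (hy : 0 < y) :
    mean f x y = y * f (x / y) := by
  rw [mean, if_pos ⟨hx, hy⟩]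

theorem diagonal_ofReal_inv {r : ι → ℝ} (hr : ∀ i, 0 < r i) :
    (diagonal (fun i => (r i : ℂ)))⁻¹ = diagonal (fun i => (((r i)⁻¹ : ℝ) : ℂ)) := by
  refine Matrix.inv_eq_left_inv ?_
  rw [diagonal_mul_diagonal, ← diagonal_one]
  congr 1
  funext i
  rw [← Complex.ofReal_mul, inv_mul_cancel₀ (hr i).ne', Complex.ofReal_one]

theorem conjTranspose_diagonal_ofReal {ι : Type*} [DecidableEq ι] (r : ι → ℝ) :
    (diagonal (fun i => (r i : ℂ)))ᴴ = diagonal (fun i => (r i : ℂ)) := by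
  rw [diagonal_conjTranspose]
  congr 1
  ext i
  simp

/-- The mean `m_f` is monotone with respect to congruences: bounds for two positive diagonal
matrices imply the same bound for their means. It is Hansen's inequality for the rescaled matrix
`diagonal (√y) * T * diagonal (1 / √y')`. -/
theorem IsMatrixMonotone.mean_le {f : ℝ → ℝ} (hf : IsMatrixMonotone f)
    {x y : ι → ℝ} {x' y' : κ → ℝ} (hx : ∀ i, 0 < x i) (hy : ∀ i, 0 < y i)
    (hx' : ∀ i, 0 < x' i) (hy' : ∀ i, 0 < y' i) {T : Matrix ι κ ℂ}
    (h₁ : Tᴴ * diagonal (fun i => (x i : ℂ)) * T ≤ diagonal (fun i => (x' i : ℂ)))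
    (h₂ : Tᴴ * diagonal (fun i => (y i : ℂ)) * T ≤ diagonal (fun i => (y' i : ℂ))) :
    Tᴴ * diagonal (fun i => (mean f (x i) (y i) : ℂ)) * T ≤
      diagonal (fun i => (mean f (x' i) (y' i) : ℂ)) := by
  set N : Matrix κ κ ℂ := diagonal (fun i => ((√(y' i))⁻¹ : ℝ)) with hN
  set N' : Matrix κ κ ℂ := diagonal (fun i => (√(y' i) : ℝ)) with hN'
  set M : Matrix ι ι ℂ := diagonal (fun i => (√(y i) : ℝ)) with hM
  have hNh : Nᴴ = N := conjTranspose_diagonal_ofReal _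
  have hNh' : N'ᴴ = N' := conjTranspose_diagonal_ofReal _
  have hMh : Mᴴ = M := conjTranspose_diagonal_ofReal _
  have hNN' : N * N' = 1 := by
    rw [hN, hN', diagonal_mul_diagonal, ← diagonal_one]
    congr 1
    funext i
    rw [← Complex.ofReal_mul, inv_mul_cancel₀ (Real.sqrt_pos.2 (hy' i)).ne', Complex.ofReal_one]
  have hN'N : N' * N = 1 := mul_eq_one_comm.1 hNN'
  have hcongr : ∀ g : ι → ℝ, (M * T * N)ᴴ * diagonal (fun i => (g i : ℂ)) * (M * T * N) =
      Nᴴ * (Tᴴ * diagonal (fun i => ((y i * g i : ℝ) : ℂ)) * T) * N := by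
    intro g
    have : diagonal (fun i => ((y i * g i : ℝ) : ℂ)) = M * diagonal (fun i => (g i : ℂ)) * M := by
      rw [hM, diagonal_mul_diagonal, diagonal_mul_diagonal]
      congr 1
      funext i
      have := Real.mul_self_sqrt (hy i).le
      norm_cast
      nth_rewrite 1 [← this]
      ring
    rw [this, conjTranspose_mul, conjTranspose_mul, hMh]
    simp only [Matrix.mul_assoc]
  have hdiag : ∀ g : κ → ℝ, Nᴴ * diagonal (fun i => (g i : ℂ)) * N =
      diagonal (fun i => ((g i / y' i : ℝ) : ℂ)) := by
    intro g
    rw [hNh, hN, diagonal_mul_diagonal, diagonal_mul_diagonal]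
    congr 1
    funext i
    have := Real.mul_self_sqrt (hy' i).le
    norm_cast
    rw [mul_right_comm, ← mul_inv, this, div_eq_inv_mul]
  have hdiv : (fun i => ((y i * (x i / y i) : ℝ) : ℂ)) = fun i => (x i : ℂ) := by
    funext i
    rw [mul_div_cancel₀ _ (hy i).ne']
  have hV : (M * T * N)ᴴ * (M * T * N) ≤ 1 := by
    have h := hcongr (fun _ => 1)
    simp only [Complex.ofReal_one, diagonal_one, Matrix.mul_one, mul_one] at h
    rw [h]
    refine (conjTranspose_mul_mul_le h₂ N).trans (le_of_eq ?_)
    rw [hdiag, ← diagonal_one]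
    congr 1
    funext i
    rw [div_self (hy' i).ne', Complex.ofReal_one]
  have h := hf.contraction_le (r := fun i => x i / y i) (s := fun i => x' i / y' i)
    (fun i => div_pos (hx i) (hy i)) (fun i => div_pos (hx' i) (hy' i)) hV (by
      rw [hcongr, hdiv, ← hdiag]
      exact conjTranspose_mul_mul_le h₁ N)
  rw [hcongr] at h
  have h' := conjTranspose_mul_mul_le h N'
  have e1 : ∀ X : Matrix κ κ ℂ, N'ᴴ * (Nᴴ * X * N) * N' = X := by
    intro X
    calc N'ᴴ * (Nᴴ * X * N) * N' = (N' * N) * X * (N * N') := by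
          rw [hNh, hNh']; simp only [Matrix.mul_assoc]
      _ = X := by rw [hNN', hN'N, Matrix.one_mul, Matrix.mul_one]
  have e2 : ∀ i, f (x' i / y' i) = mean f (x' i) (y' i) / y' i := by
    intro i
    rw [mean_of_pos f (hx' i) (hy' i), mul_div_cancel_left₀ _ (hy' i).ne']
  simp only [e2] at h'
  rw [e1, ← hdiag, e1] at h'
  simpa only [mean_of_pos f (hx _) (hy _)] using h'

/-- Inversion of a congruence bound, by taking both Schur complements of the block matrix with
diagonal blocks `diagonal (1 / p)`, `diagonal q` and off-diagonal block `T`. -/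
theorem mul_diagonal_inv_mul_le {p : ι → ℝ} {q : κ → ℝ} (hp : ∀ i, 0 < p i) (hq : ∀ i, 0 < q i)
    {T : Matrix ι κ ℂ}
    (h : Tᴴ * diagonal (fun i => (p i : ℂ)) * T ≤ diagonal (fun i => (q i : ℂ))) :
    T * diagonal (fun i => (((q i)⁻¹ : ℝ) : ℂ)) * Tᴴ ≤ diagonal (fun i => (((p i)⁻¹ : ℝ) : ℂ)) := by
  have hP : (diagonal (fun i => (p i : ℂ))).PosDef := PosDef.diagonal fun i => by simpa using hp i
  have hQ : (diagonal (fun i => (q i : ℂ))).PosDef := PosDef.diagonal fun i => by simpa using hq i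
  have := hQ.isUnit.invertible
  have := hP.inv.isUnit.invertible
  rw [Matrix.le_iff] at h ⊢
  rw [← diagonal_ofReal_inv hq, ← diagonal_ofReal_inv hp, ← PosDef.fromBlocks₂₂ _ T hQ,
    PosDef.fromBlocks₁₁ T _ hP.inv,
    Matrix.nonsing_inv_nonsing_inv _ ((Matrix.isUnit_iff_isUnit_det _).1 hP.isUnit)]
  exact h

/-- A column of `T` vanishes if its weight in the upper bound does. Applied to a channel, this says
that the images of all matrices are supported on the support of the image of an invertible `D`. -/
theorem eq_zero_of_conjTranspose_mul_diagonal_mul_le {ι κ : Type*} [Fintype ι]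
    [DecidableEq ι] [DecidableEq κ] {x : ι → ℝ} {x' : κ → ℝ}
    (hx : ∀ i, 0 < x i) {T : Matrix ι κ ℂ}
    (h : Tᴴ * diagonal (fun i => (x i : ℂ)) * T ≤ diagonal (fun i => (x' i : ℂ)))
    {k : κ} (hk : x' k = 0) (i : ι) : T i k = 0 := by
  have h0 := (Matrix.le_iff.1 h).diag_nonneg (i := k)
  have e : ∀ a, star (T a k) * (x a : ℂ) * T a k = ((x a * Complex.normSq (T a k) : ℝ) : ℂ) := by
    intro a
    rw [Complex.ofReal_mul, ← Complex.mul_conj]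
    simp only [Complex.star_def]
    ring
  rw [Matrix.sub_apply, diagonal_apply_eq, hk, conjTranspose_mul_diagonal_mul_apply,
    Complex.ofReal_zero, zero_sub, Finset.sum_congr rfl fun a _ => e a, ← Complex.ofReal_sum,
    ← Complex.ofReal_neg, Complex.zero_le_real, neg_nonneg] at h0
  have hnn : ∀ a ∈ Finset.univ, 0 ≤ x a * Complex.normSq (T a k) :=
    fun a _ => mul_nonneg (hx a).le (Complex.normSq_nonneg _)
  have := (Finset.sum_eq_zero_iff_of_nonneg hnn).1 (le_antisymm h0 (Finset.sum_nonneg hnn)) i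
    (Finset.mem_univ i)
  exact Complex.normSq_eq_zero.1 ((mul_eq_zero.1 this).resolve_left (hx i).ne')

/-- The dual bound for the reciprocal means. The weights `x'`, `y'` may vanish: the corresponding
columns of `T` are then zero, so the boundary values of the mean do not matter. -/
theorem IsMatrixMonotone.inv_mean_le {f : ℝ → ℝ} (hf : IsMatrixMonotone f)
    {x y : ι → ℝ} {x' y' : κ → ℝ} (hx : ∀ i, 0 < x i) (hy : ∀ i, 0 < y i)
    (hx' : ∀ i, 0 ≤ x' i) (hy' : ∀ i, 0 ≤ y' i) {T : Matrix ι κ ℂ}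
    (h₁ : Tᴴ * diagonal (fun i => (x i : ℂ)) * T ≤ diagonal (fun i => (x' i : ℂ)))
    (h₂ : Tᴴ * diagonal (fun i => (y i : ℂ)) * T ≤ diagonal (fun i => (y' i : ℂ))) :
    T * diagonal (fun i => (((mean f (x' i) (y' i))⁻¹ : ℝ) : ℂ)) * Tᴴ ≤
      diagonal (fun i => (((mean f (x i) (y i))⁻¹ : ℝ) : ℂ)) := by
  classical
  -- Replacing vanishing weights by `1` keeps the bounds and affects only zero columns of `T`.
  let reg : (κ → ℝ) → κ → ℝ := fun w i => if w i = 0 then 1 else w i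
  have reg_pos : ∀ {w : κ → ℝ}, (∀ i, 0 ≤ w i) → ∀ i, 0 < reg w i := by
    intro w hw i
    by_cases h : w i = 0
    · simp [reg, h]
    · simpa [reg, h] using lt_of_le_of_ne (hw i) (Ne.symm h)
  have le_reg : ∀ w : κ → ℝ, ∀ i, w i ≤ reg w i := by
    intro w i
    by_cases h : w i = 0 <;> simp [reg, h]
  have hm := mul_diagonal_inv_mul_le
    (fun i => mean_pos hf.pos (hx i) (hy i))
    (fun i => mean_pos hf.pos (reg_pos hx' i) (reg_pos hy' i))
    (hf.mean_le hx hy (reg_pos hx') (reg_pos hy')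
      (h₁.trans (diagonal_le_diagonal (le_reg x'))) (h₂.trans (diagonal_le_diagonal (le_reg y'))))
  refine le_trans (le_of_eq ?_) hm
  congr 1
  ext i k
  rw [Matrix.mul_diagonal, Matrix.mul_diagonal]
  by_cases hxk : x' k = 0
  · simp [eq_zero_of_conjTranspose_mul_diagonal_mul_le hx h₁ hxk i]
  by_cases hyk : y' k = 0
  · simp [eq_zero_of_conjTranspose_mul_diagonal_mul_le hy h₂ hyk i]
  simp [reg, hxk, hyk]

end Interpolation

/-! ### Two-positivity of a completely positive map -/

section Channel

variable {n m : ℕ}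

/-- Stated for an abstract C⋆-algebra: for `CStarMatrix` with matrix entries, instance search does
not find the functional calculus by itself. -/
theorem exists_eq_star_mul_self_of_nonneg {A : Type*} [NonUnitalCStarAlgebra A] [PartialOrder A]
    [StarOrderedRing A] {a : A} (h : 0 ≤ a) : ∃ b, a = star b * b :=
  CStarAlgebra.nonneg_iff_eq_star_mul_self.1 h

/-- A Kolmogorov decomposition of the positive kernel `(i, j) ↦ β (v iᴴ * v j)` attached to a
completely positive map; a substitute for the Kraus or Stinespring representation of `β`. -/
theorem exists_map_conjTranspose_mul_eq_sum
    (β : Matrix (Fin n) (Fin n) ℂ →CP Matrix (Fin m) (Fin m) ℂ) {k : ℕ} [NeZero k]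
    (v : Fin k → Matrix (Fin n) (Fin n) ℂ) :
    ∃ L : Fin k → Fin k → Matrix (Fin m) (Fin m) ℂ,
      ∀ i j, β ((v i)ᴴ * v j) = ∑ a, (L a i)ᴴ * L a j := by
  -- `N` has first row `v` and zeros elsewhere.
  let N : CStarMatrix (Fin k) (Fin k) (Matrix (Fin n) (Fin n) ℂ) :=
    CStarMatrix.ofMatrix (fun a j => if a = 0 then v j else 0)
  have hN' : ∀ a j, N a j = if a = 0 then v j else 0 := fun _ _ => rfl
  have hN : ∀ i j, (star N * N) i j = (v i)ᴴ * v j := by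
    intro i j
    rw [CStarMatrix.mul_apply, Finset.sum_eq_single 0]
    · rw [CStarMatrix.star_apply, hN', hN', if_pos rfl, if_pos rfl, Matrix.star_eq_conjTranspose]
    · intro a _ ha
      rw [hN' a j, if_neg ha, mul_zero]
    · simp
  obtain ⟨L, hL⟩ := exists_eq_star_mul_self_of_nonneg
    (A := CStarMatrix (Fin k) (Fin k) (Matrix (Fin m) (Fin m) ℂ))
    (β.map_cstarMatrix_nonneg _ (star_mul_self_nonneg N))
  refine ⟨fun a i => L a i, fun i j => ?_⟩
  have := congrArg (fun M : CStarMatrix (Fin k) (Fin k) _ => M i j) hL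
  simpa only [CStarMatrix.map_apply, hN, CStarMatrix.mul_apply, CStarMatrix.star_apply,
    Matrix.star_eq_conjTranspose] using this

theorem posSemidef_sum_conjTranspose_mul_map_mul
    (β : Matrix (Fin n) (Fin n) ℂ →CP Matrix (Fin m) (Fin m) ℂ) {k : ℕ} [NeZero k]
    (v : Fin k → Matrix (Fin n) (Fin n) ℂ) (w : Fin k → Matrix (Fin m) (Fin m) ℂ) :
    (∑ i, ∑ j, (w i)ᴴ * β ((v i)ᴴ * v j) * w j).PosSemidef := by
  obtain ⟨L, hβ⟩ := exists_map_conjTranspose_mul_eq_sum β v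
  have hsum : ∑ i, ∑ j, (w i)ᴴ * β ((v i)ᴴ * v j) * w j =
      ∑ a, (∑ i, L a i * w i)ᴴ * ∑ j, L a j * w j := by
    simp only [hβ, conjTranspose_sum, conjTranspose_mul, Matrix.sum_mul, Matrix.mul_sum,
      Matrix.mul_assoc]
    calc _ = ∑ i, ∑ a, ∑ j, (w i)ᴴ * ((L a i)ᴴ * (L a j * w j)) :=
          Finset.sum_congr rfl fun i _ => Finset.sum_comm
      _ = ∑ a, ∑ i, ∑ j, (w i)ᴴ * ((L a i)ᴴ * (L a j * w j)) := Finset.sum_comm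
      _ = _ := Finset.sum_congr rfl fun a _ => Finset.sum_comm
  rw [hsum]
  exact posSemidef_sum _ fun a _ => posSemidef_conjTranspose_mul_self _

theorem map_posSemidef (β : Matrix (Fin n) (Fin n) ℂ →CP Matrix (Fin m) (Fin m) ℂ)
    {A : Matrix (Fin n) (Fin n) ℂ} (hA : A.PosSemidef) : (β A).PosSemidef := by
  obtain ⟨S, rfl⟩ := posSemidef_exists_eq_conjTranspose_mul_self hA
  simpa using posSemidef_sum_conjTranspose_mul_map_mul β (k := 1) (fun _ => S) (fun _ => 1)

theorem map_conjTranspose (β : Matrix (Fin n) (Fin n) ℂ →CP Matrix (Fin m) (Fin m) ℂ)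
    (A : Matrix (Fin n) (Fin n) ℂ) : β Aᴴ = (β A)ᴴ := by
  obtain ⟨L, hβ⟩ := exists_map_conjTranspose_mul_eq_sum β ![1, A]
  have h1 := hβ 1 0
  have h2 := hβ 0 1
  simp only [cons_val_zero, cons_val_one, conjTranspose_one, Matrix.mul_one,
    Matrix.one_mul] at h1 h2
  rw [h1, h2, conjTranspose_sum]
  simp only [conjTranspose_mul, conjTranspose_conjTranspose]

/-- The map `Z ↦ U'ᴴ β(U Z Uᴴ) U'`, i.e. `β` written in the bases given by `U` and `U'`. -/
noncomputable def conjMap (β : Matrix (Fin n) (Fin n) ℂ →CP Matrix (Fin m) (Fin m) ℂ)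
    (U : Matrix (Fin n) (Fin n) ℂ) (U' : Matrix (Fin m) (Fin m) ℂ) :
    Matrix (Fin n) (Fin n) ℂ →ₗ[ℂ] Matrix (Fin m) (Fin m) ℂ where
  toFun Z := U'ᴴ * β (U * Z * Uᴴ) * U'
  map_add' A B := by
    rw [Matrix.mul_add, Matrix.add_mul, map_add, Matrix.mul_add, Matrix.add_mul]
  map_smul' c A := by
    rw [Matrix.mul_smul, Matrix.smul_mul, map_smul, Matrix.mul_smul, Matrix.smul_mul,
      RingHom.id_apply]

theorem conjMap_apply (β : Matrix (Fin n) (Fin n) ℂ →CP Matrix (Fin m) (Fin m) ℂ)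
    (U : Matrix (Fin n) (Fin n) ℂ) (U' : Matrix (Fin m) (Fin m) ℂ)
    (Z : Matrix (Fin n) (Fin n) ℂ) :
    conjMap β U U' Z = U'ᴴ * β (U * Z * Uᴴ) * U' := rfl

theorem conjMap_conjTranspose (β : Matrix (Fin n) (Fin n) ℂ →CP Matrix (Fin m) (Fin m) ℂ)
    (U : Matrix (Fin n) (Fin n) ℂ) (U' : Matrix (Fin m) (Fin m) ℂ)
    (Z : Matrix (Fin n) (Fin n) ℂ) : conjMap β U U' Zᴴ = (conjMap β U U' Z)ᴴ := by
  have : U * Zᴴ * Uᴴ = (U * Z * Uᴴ)ᴴ := by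
    simp only [conjTranspose_mul, conjTranspose_conjTranspose, Matrix.mul_assoc]
  rw [conjMap_apply, conjMap_apply, this, map_conjTranspose]
  simp only [conjTranspose_mul, conjTranspose_conjTranspose, Matrix.mul_assoc]

theorem trace_conjMap {β : Matrix (Fin n) (Fin n) ℂ →CP Matrix (Fin m) (Fin m) ℂ}
    (hβ : ∀ X : Matrix (Fin n) (Fin n) ℂ, (β X).trace = X.trace)
    {U : Matrix (Fin n) (Fin n) ℂ} {U' : Matrix (Fin m) (Fin m) ℂ} (hU : Uᴴ * U = 1)
    (hU' : U' * U'ᴴ = 1) (Z : Matrix (Fin n) (Fin n) ℂ) :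
    (conjMap β U U' Z).trace = Z.trace := by
  rw [conjMap_apply, trace_mul_comm, ← Matrix.mul_assoc, hU', Matrix.one_mul, hβ, trace_mul_comm,
    ← Matrix.mul_assoc, hU, Matrix.one_mul]

/-- Two-positivity of `β` applied to the positive block matrix with first row `(Y D Yᴴ, Y D)` and
second row `(D Yᴴ, D)`, and compressed with `(1, -Xᴴ)`. It carries the same information as the
Schwarz inequality for the adjoint of `β`, weighted by `D`. -/
theorem posSemidef_conjMap (β : Matrix (Fin n) (Fin n) ℂ →CP Matrix (Fin m) (Fin m) ℂ)
    (U : Matrix (Fin n) (Fin n) ℂ) (U' : Matrix (Fin m) (Fin m) ℂ)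
    {D : Matrix (Fin n) (Fin n) ℂ} (hD : D.PosSemidef) (Y : Matrix (Fin n) (Fin n) ℂ)
    (X : Matrix (Fin m) (Fin m) ℂ) :
    (conjMap β U U' (Y * D * Yᴴ) - conjMap β U U' (Y * D) * Xᴴ - X * conjMap β U U' (D * Yᴴ) +
      X * conjMap β U U' D * Xᴴ).PosSemidef := by
  obtain ⟨S, rfl⟩ := posSemidef_exists_eq_conjTranspose_mul_self hD
  convert posSemidef_sum_conjTranspose_mul_map_mul β (k := 2) ![S * Yᴴ * Uᴴ, S * Uᴴ]
    ![U', -(U' * Xᴴ)] using 1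
  simp only [Fin.sum_univ_two, cons_val_zero, cons_val_one, conjMap_apply,
    conjTranspose_mul, conjTranspose_conjTranspose, conjTranspose_neg, Matrix.mul_assoc,
    Matrix.mul_neg, Matrix.neg_mul, neg_neg]
  abel

end Channel

/-! ### The adjoint of a channel in eigenbases -/

section Coordinates

variable {n m : ℕ}

/-- The matrix, in the bases of matrix units, of the Hilbert-Schmidt adjoint of a linear map
`φ : M_n → M_m`. -/
noncomputable def adjointMatrix (φ : Matrix (Fin n) (Fin n) ℂ →ₗ[ℂ] Matrix (Fin m) (Fin m) ℂ) :
    Matrix (Fin n × Fin n) (Fin m × Fin m) ℂ :=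
  Matrix.of fun a c => star (φ (Matrix.single a.1 a.2 1) c.1 c.2)

theorem adjointMatrix_conjTranspose_mulVec
    (φ : Matrix (Fin n) (Fin n) ℂ →ₗ[ℂ] Matrix (Fin m) (Fin m) ℂ)
    (A : Matrix (Fin n) (Fin n) ℂ) :
    (adjointMatrix φ)ᴴ *ᵥ (fun a => A a.1 a.2) = fun c => φ A c.1 c.2 := by
  funext c
  have hA : φ A = ∑ a : Fin n × Fin n, A a.1 a.2 • φ (Matrix.single a.1 a.2 1) := by
    conv_lhs => rw [matrix_eq_sum_single A]
    simp only [map_sum, Fintype.sum_prod_type, ← map_smul, smul_single, smul_eq_mul, mul_one]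
  rw [hA, Matrix.sum_apply]
  simp only [mulVec, dotProduct, adjointMatrix, conjTranspose_apply, Matrix.of_apply, star_star,
    Matrix.smul_apply, smul_eq_mul, mul_comm]

theorem trace_mul_conjTranspose_eq_dotProduct (A B : Matrix (Fin n) (Fin n) ℂ) :
    (A * Bᴴ).trace = star (fun a : Fin n × Fin n => B a.1 a.2) ⬝ᵥ (fun a => A a.1 a.2) := by
  simp only [Matrix.trace, Matrix.diag_apply, Matrix.mul_apply, dotProduct, Pi.star_apply,
    conjTranspose_apply, Fintype.sum_prod_type, mul_comm]

/-- The bound `φ ℝ_D φ* ≤ ℝ_{φ(D)}` in coordinates, for `φ = conjMap β U U'`, where `φ*` is the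
Hilbert-Schmidt adjoint and `D`, `φ(D)` are diagonal. -/
theorem adjointMatrix_mul_snd_le
    {β : Matrix (Fin n) (Fin n) ℂ →CP Matrix (Fin m) (Fin m) ℂ}
    (hβ : ∀ X : Matrix (Fin n) (Fin n) ℂ, (β X).trace = X.trace)
    {U : Matrix (Fin n) (Fin n) ℂ} {U' : Matrix (Fin m) (Fin m) ℂ} (hU : Uᴴ * U = 1)
    (hU' : U' * U'ᴴ = 1) {l : Fin n → ℝ} {l' : Fin m → ℝ} (hl : ∀ i, 0 ≤ l i)
    (hD : conjMap β U U' (diagonal (fun i => (l i : ℂ))) = diagonal (fun i => (l' i : ℂ))) :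
    (adjointMatrix (conjMap β U U'))ᴴ * diagonal (fun a : Fin n × Fin n => (l a.2 : ℂ)) *
        adjointMatrix (conjMap β U U') ≤ diagonal (fun c : Fin m × Fin m => (l' c.2 : ℂ)) := by
  set φ := conjMap β U U' with hφ
  set T := adjointMatrix φ with hT
  set D : Matrix (Fin n) (Fin n) ℂ := diagonal (fun i => (l i : ℂ)) with hDdef
  have hDpos : D.PosSemidef := PosSemidef.diagonal fun i => by simpa using hl i
  have herm : (Tᴴ * diagonal (fun a : Fin n × Fin n => (l a.2 : ℂ)) * T).IsHermitian :=
    isHermitian_conjTranspose_mul_mul _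
      (conjTranspose_diagonal_ofReal fun a : Fin n × Fin n => l a.2)
  rw [Matrix.le_iff]
  refine PosSemidef.of_dotProduct_mulVec_nonneg
    (IsHermitian.sub (conjTranspose_diagonal_ofReal fun c : Fin m × Fin m => l' c.2) herm)
    fun x => ?_
  let X : Matrix (Fin m) (Fin m) ℂ := Matrix.of fun c d => x (c, d)
  let Y : Matrix (Fin n) (Fin n) ℂ := Matrix.of fun a b => (T *ᵥ x) (a, b)
  have hYD : (fun a : Fin n × Fin n => (Y * D) a.1 a.2) =
      diagonal (fun a : Fin n × Fin n => (l a.2 : ℂ)) *ᵥ (T *ᵥ x) := by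
    funext a
    rw [hDdef, Matrix.mul_diagonal, mulVec_diagonal]
    simp [Y, mul_comm]
  have hXD : (fun c : Fin m × Fin m => (X * diagonal (fun i => (l' i : ℂ))) c.1 c.2) =
      diagonal (fun c : Fin m × Fin m => (l' c.2 : ℂ)) *ᵥ x := by
    funext c
    rw [Matrix.mul_diagonal, mulVec_diagonal]
    simp [X, mul_comm]
  -- Both mixed traces equal the trace of the first term, because `Y` is the adjoint of `φ` at `X`.
  set q : ℂ := star (T *ᵥ x) ⬝ᵥ (diagonal (fun a : Fin n × Fin n => (l a.2 : ℂ)) *ᵥ (T *ᵥ x))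
    with hq
  have t1 : (φ (Y * D * Yᴴ)).trace = q := by
    rw [hφ, trace_conjMap hβ hU hU', trace_mul_conjTranspose_eq_dotProduct, hYD]
    rfl
  have t2 : (φ (Y * D) * Xᴴ).trace = q := by
    rw [trace_mul_conjTranspose_eq_dotProduct, ← adjointMatrix_conjTranspose_mulVec, hYD,
      dotProduct_mulVec, ← star_mulVec]
    rfl
  have hqs : star q = q := by
    have := congrArg star t1
    rw [← trace_conjTranspose, hφ, ← conjMap_conjTranspose, ← hφ] at this
    rw [← this, ← t1]
    simp only [conjTranspose_mul, conjTranspose_conjTranspose, hDpos.1.eq, Matrix.mul_assoc]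
  have t3 : (X * φ (D * Yᴴ)).trace = q := by
    have : X * φ (D * Yᴴ) = (φ (Y * D) * Xᴴ)ᴴ := by
      rw [conjTranspose_mul, conjTranspose_conjTranspose, hφ, ← conjMap_conjTranspose,
        conjTranspose_mul, hDpos.1.eq]
    rw [this, trace_conjTranspose, t2, hqs]
  have t4 : (X * φ D * Xᴴ).trace =
      star x ⬝ᵥ (diagonal (fun c : Fin m × Fin m => (l' c.2 : ℂ)) *ᵥ x) := by
    rw [hD, trace_mul_conjTranspose_eq_dotProduct, hXD]
    rfl
  have := (posSemidef_conjMap β U U' hDpos Y X).trace_nonneg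
  rw [← hφ, trace_add, trace_sub, trace_sub, t1, t2, t3, t4] at this
  rw [sub_mulVec, dotProduct_sub, ← mulVec_mulVec, ← mulVec_mulVec, dotProduct_mulVec (star x) Tᴴ,
    ← star_mulVec, ← hq]
  convert this using 1
  ring

/-- The bound `φ 𝕃_D φ* ≤ 𝕃_{φ(D)}` in coordinates; it follows from the one for `ℝ_D` as `φ`
commutes with taking adjoints. -/
theorem adjointMatrix_mul_fst_le
    {β : Matrix (Fin n) (Fin n) ℂ →CP Matrix (Fin m) (Fin m) ℂ}
    (hβ : ∀ X : Matrix (Fin n) (Fin n) ℂ, (β X).trace = X.trace)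
    {U : Matrix (Fin n) (Fin n) ℂ} {U' : Matrix (Fin m) (Fin m) ℂ} (hU : Uᴴ * U = 1)
    (hU' : U' * U'ᴴ = 1) {l : Fin n → ℝ} {l' : Fin m → ℝ} (hl : ∀ i, 0 ≤ l i)
    (hD : conjMap β U U' (diagonal (fun i => (l i : ℂ))) = diagonal (fun i => (l' i : ℂ))) :
    (adjointMatrix (conjMap β U U'))ᴴ * diagonal (fun a : Fin n × Fin n => (l a.1 : ℂ)) *
        adjointMatrix (conjMap β U U') ≤ diagonal (fun c : Fin m × Fin m => (l' c.1 : ℂ)) := by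
  have h := adjointMatrix_mul_snd_le hβ hU hU' hl hD
  set T := adjointMatrix (conjMap β U U') with hT
  have hswap : ∀ a c, T a c = star (T a.swap c.swap) := by
    intro a c
    have : Matrix.single a.1 a.2 (1 : ℂ) = (Matrix.single a.2 a.1 1)ᴴ := by simp
    simp only [hT, adjointMatrix, Matrix.of_apply, Prod.fst_swap, Prod.snd_swap, star_star]
    rw [this, conjMap_conjTranspose, conjTranspose_apply, star_star]
  rw [Matrix.le_iff] at h ⊢
  refine (congrArg PosSemidef ?_).mpr (h.submatrix Prod.swap).transpose
  ext c d
  simp only [transpose_apply, submatrix_apply, Matrix.sub_apply,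
    conjTranspose_mul_diagonal_mul_apply]
  congr 1
  · by_cases hcd : c = d
    · subst hcd; simp
    · rw [diagonal_apply_ne _ hcd,
        diagonal_apply_ne _ (fun h' => hcd (Prod.swap_injective h').symm)]
  · rw [← (Equiv.prodComm (Fin n) (Fin n)).sum_comp]
    refine Finset.sum_congr rfl fun a _ => ?_
    simp only [Equiv.prodComm_apply, Prod.fst_swap]
    rw [hswap a.swap c, hswap a.swap d, Prod.swap_swap, star_star]
    ring

end Coordinates

/-! ### The Fisher information matrix as a Gram matrix -/

section Fisher

variable {n m k : ℕ}

theorem hadamardOp_apply (U : unitary (Matrix (Fin n) (Fin n) ℂ)) (g : Fin n → Fin n → ℂ)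
    (B : Matrix (Fin n) (Fin n) ℂ) :
    hadamardOp U g B = (U : Matrix (Fin n) (Fin n) ℂ) *
      (Matrix.of g ⊙ ((U : Matrix (Fin n) (Fin n) ℂ)ᴴ * B * U)) *
        (U : Matrix (Fin n) (Fin n) ℂ)ᴴ := rfl

theorem unitary_conjTranspose_mul (U : unitary (Matrix (Fin n) (Fin n) ℂ)) :
    (U : Matrix (Fin n) (Fin n) ℂ)ᴴ * U = 1 := Unitary.coe_star_mul_self U

theorem unitary_mul_conjTranspose (U : unitary (Matrix (Fin n) (Fin n) ℂ)) :
    (U : Matrix (Fin n) (Fin n) ℂ) * (U : Matrix (Fin n) (Fin n) ℂ)ᴴ = 1 :=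
  Unitary.coe_mul_star_self U

/-- The form `Tr L_A 𝕁_D(L_B)` with `L_A = 𝕁_D⁻¹ A`, `L_B = 𝕁_D⁻¹ B` in an eigenbasis of `D`. The
condition on `B` says that the Moore-Penrose inverse acts on it as an actual inverse. -/
theorem trace_jInv_mul_jOp_jInv (f : ℝ → ℝ) {D : Matrix (Fin n) (Fin n) ℂ} (hD : D.IsHermitian)
    {A B : Matrix (Fin n) (Fin n) ℂ} (hA : A.IsHermitian)
    {U : Matrix (Fin n) (Fin n) ℂ} (hU : U = hD.eigenvectorUnitary)
    (hB : ∀ a b, (Uᴴ * B * U) a b ≠ 0 → mean f (hD.eigenvalues a) (hD.eigenvalues b) ≠ 0) :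
    (jInv f D A * jOp f D (jInv f D B)).trace =
      ∑ c : Fin n × Fin n, star ((Uᴴ * A * U) c.1 c.2) *
        (((mean f (hD.eigenvalues c.2) (hD.eigenvalues c.1))⁻¹ : ℝ) : ℂ) *
          (Uᴴ * B * U) c.1 c.2 := by
  have h1 : Uᴴ * U = 1 := hU ▸ unitary_conjTranspose_mul _
  have hAh : (Uᴴ * A * U).IsHermitian := isHermitian_conjTranspose_mul_mul U hA
  rw [jInv, jOp, dif_pos hD, dif_pos hD, ← LinearMap.comp_apply, ← hadamardOp_comp,
    hadamardOp_apply, hadamardOp_apply, ← hU]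
  set a := Uᴴ * A * U with ha
  set b := Uᴴ * B * U with hb
  generalize hg : Matrix.of (fun i j =>
    (((mean f (hD.eigenvalues i) (hD.eigenvalues j))⁻¹ : ℝ) : ℂ)) = g
  have hgb : Matrix.of ((fun i j => ((mean f (hD.eigenvalues i) (hD.eigenvalues j) : ℝ) : ℂ)) *
      fun i j => (((mean f (hD.eigenvalues i) (hD.eigenvalues j))⁻¹ : ℝ) : ℂ)) ⊙ b = b := by
    ext i j
    by_cases h0 : b i j = 0
    · simp [h0]
    · have := hB i j h0
      simp [this]
  rw [hgb]
  have htr : (U * (g ⊙ a) * Uᴴ * (U * b * Uᴴ)).trace = ((g ⊙ a) * b).trace := by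
    calc (U * (g ⊙ a) * Uᴴ * (U * b * Uᴴ)).trace
        = (U * ((g ⊙ a) * ((Uᴴ * U) * b * Uᴴ))).trace := by simp only [Matrix.mul_assoc]
      _ = ((g ⊙ a) * b * (Uᴴ * U)).trace := by
          rw [h1, Matrix.one_mul, trace_mul_comm, Matrix.mul_one, ← Matrix.mul_assoc,
            Matrix.mul_assoc, h1, Matrix.mul_one]
      _ = _ := by rw [h1, Matrix.mul_one]
  rw [htr]
  simp only [Matrix.trace, Matrix.diag_apply, Matrix.mul_apply, hadamard_apply,
    Fintype.sum_prod_type]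
  rw [Finset.sum_comm]
  refine Finset.sum_congr rfl fun i _ => Finset.sum_congr rfl fun j _ => ?_
  rw [hAh.apply, ← hg, Matrix.of_apply, mul_comm (a j i)]

/-- The matrix whose columns are the matrices `A i`, written in the basis given by `U` and
flattened to vectors; it is used for the partial derivatives of a family of density matrices. -/
noncomputable def derivMatrix (U : Matrix (Fin n) (Fin n) ℂ)
    (A : Fin k → Matrix (Fin n) (Fin n) ℂ) : Matrix (Fin n × Fin n) (Fin k) ℂ :=
  Matrix.of fun c i => (Uᴴ * A i * U) c.1 c.2

/-- The Fisher information matrix is the Gram matrix of the partial derivatives for the form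
given by the reciprocal means of the eigenvalues. -/
theorem fisherMatrix_eq (f : ℝ → ℝ) (ρ : (Fin k → ℝ) → Matrix (Fin n) (Fin n) ℂ) (θ : Fin k → ℝ)
    (hD : (ρ θ).IsHermitian) (hA : ∀ i, (partialDeriv ρ θ i).IsHermitian)
    {U : Matrix (Fin n) (Fin n) ℂ} (hU : U = hD.eigenvectorUnitary)
    (hB : ∀ i a b, (Uᴴ * partialDeriv ρ θ i * U) a b ≠ 0 →
      mean f (hD.eigenvalues a) (hD.eigenvalues b) ≠ 0) :
    fisherMatrix f ρ θ = (derivMatrix U (partialDeriv ρ θ))ᴴ *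
      diagonal (fun c : Fin n × Fin n =>
        (((mean f (hD.eigenvalues c.2) (hD.eigenvalues c.1))⁻¹ : ℝ) : ℂ)) *
          derivMatrix U (partialDeriv ρ θ) := by
  ext i j
  rw [conjTranspose_mul_diagonal_mul_apply]
  exact trace_jInv_mul_jOp_jInv f hD (hA i) hU (hB j)

theorem partialDeriv_eq_of_hasFDerivAt {ρ : (Fin k → ℝ) → Matrix (Fin n) (Fin n) ℂ}
    {θ : Fin k → ℝ} {ρ' : (Fin k → ℝ) →L[ℝ] Matrix (Fin n) (Fin n) ℂ} (h : HasFDerivAt ρ ρ' θ)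
    (i : Fin k) : partialDeriv ρ θ i = ρ' (Pi.single i 1) :=
  (h.hasLineDerivAt _).lineDeriv

theorem partialDeriv_isHermitian {ρ : (Fin k → ℝ) → Matrix (Fin n) (Fin n) ℂ} {θ : Fin k → ℝ}
    (hd : DifferentiableAt ℝ ρ θ) (hρ : ∀ᶠ t in nhds θ, (ρ t).IsHermitian) (i : Fin k) :
    (partialDeriv ρ θ i).IsHermitian := by
  have h1 := hd.hasFDerivAt
  have h2 : HasFDerivAt (fun t => star (ρ t)) (fderiv ℝ ρ θ) θ :=
    h1.congr_of_eventuallyEq (hρ.mono fun t ht => ht)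
  have h3 := h1.star.unique h2
  rw [partialDeriv_eq_of_hasFDerivAt h1]
  exact congrArg (fun L => L (Pi.single i 1)) h3

theorem partialDeriv_map (β : Matrix (Fin n) (Fin n) ℂ →CP Matrix (Fin m) (Fin m) ℂ)
    {ρ : (Fin k → ℝ) → Matrix (Fin n) (Fin n) ℂ} {θ : Fin k → ℝ}
    (hd : DifferentiableAt ℝ ρ θ) (i : Fin k) :
    partialDeriv (fun t => β (ρ t)) θ i = β (partialDeriv ρ θ i) := by
  let b : Matrix (Fin n) (Fin n) ℂ →L[ℝ] Matrix (Fin m) (Fin m) ℂ :=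
    LinearMap.toContinuousLinearMap (β.toLinearMap.restrictScalars ℝ)
  rw [partialDeriv_eq_of_hasFDerivAt hd.hasFDerivAt]
  exact partialDeriv_eq_of_hasFDerivAt (b.hasFDerivAt.comp θ hd.hasFDerivAt) i

theorem eigenvectorUnitary_conj_eq_diagonal {D : Matrix (Fin n) (Fin n) ℂ} (hD : D.IsHermitian)
    {U : Matrix (Fin n) (Fin n) ℂ} (hU : U = hD.eigenvectorUnitary) :
    U * diagonal (fun i => (hD.eigenvalues i : ℂ)) * Uᴴ = D := by
  subst hU
  exact hD.spectral_theorem.symm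

end Fisher

end QuantumFisher

/-! ### Monotonicity -/

theorem mainTheorem4 {n m k : ℕ} (f : ℝ → ℝ) (hf : QuantumFisher.IsMatrixMonotone f)
    (β : Matrix (Fin n) (Fin n) ℂ →CP Matrix (Fin m) (Fin m) ℂ)
    (hβ : ∀ X : Matrix (Fin n) (Fin n) ℂ, (β X).trace = X.trace)
    (G : Set (Fin k → ℝ)) (hG : IsOpen G)
    (ρ : (Fin k → ℝ) → Matrix (Fin n) (Fin n) ℂ)
    (hρ_smooth : ContDiffOn ℝ ∞ ρ G)
    (hρ_density : ∀ θ ∈ G, QuantumFisher.IsDensity (ρ θ))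
    (hρ_inv : ∀ θ ∈ G, IsUnit (ρ θ)) :
    ∀ θ ∈ G, QuantumFisher.fisherMatrix f (fun t => β (ρ t)) θ ≤
      QuantumFisher.fisherMatrix f ρ θ := by
  open QuantumFisher in
  intro θ hθ
  have hd : DifferentiableAt ℝ ρ θ :=
    (hρ_smooth.contDiffAt (hG.mem_nhds hθ)).differentiableAt (by simp)
  have hD : (ρ θ).PosDef :=
    ((hρ_density θ hθ).posSemidef.posDef_iff_isUnit).2 (hρ_inv θ hθ)
  have hD' : (β (ρ θ)).PosSemidef := map_posSemidef β hD.posSemidef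
  have hA : ∀ i, (partialDeriv ρ θ i).IsHermitian := partialDeriv_isHermitian hd
    (Filter.eventually_of_mem (hG.mem_nhds hθ) fun t ht => (hρ_density t ht).posSemidef.1)
  have hA' : ∀ i, (partialDeriv (fun t => β (ρ t)) θ i).IsHermitian := by
    intro i
    rw [partialDeriv_map β hd, Matrix.IsHermitian, ← map_conjTranspose, (hA i).eq]
  obtain ⟨U, hU⟩ : ∃ U : Matrix (Fin n) (Fin n) ℂ, U = hD.1.eigenvectorUnitary := ⟨_, rfl⟩
  obtain ⟨U', hU'⟩ : ∃ U' : Matrix (Fin m) (Fin m) ℂ, U' = hD'.1.eigenvectorUnitary := ⟨_, rfl⟩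
  have hU1 : Uᴴ * U = 1 := hU ▸ unitary_conjTranspose_mul _
  have hU2 : U * Uᴴ = 1 := hU ▸ unitary_mul_conjTranspose _
  have hU1' : U'ᴴ * U' = 1 := hU' ▸ unitary_conjTranspose_mul _
  have hU2' : U' * U'ᴴ = 1 := hU' ▸ unitary_mul_conjTranspose _
  have hφD : conjMap β U U' (diagonal (fun i => (hD.1.eigenvalues i : ℂ))) =
      diagonal (fun i => (hD'.1.eigenvalues i : ℂ)) := by
    rw [conjMap_apply, eigenvectorUnitary_conj_eq_diagonal hD.1 hU]
    conv_lhs => rw [← eigenvectorUnitary_conj_eq_diagonal hD'.1 hU']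
    rw [Matrix.mul_assoc, Matrix.mul_assoc, hU1', Matrix.mul_one, ← Matrix.mul_assoc, hU1',
      Matrix.one_mul]
  have hl := fun i => hD.eigenvalues_pos i
  have hl' := fun i => hD'.eigenvalues_nonneg i
  have h₁ := adjointMatrix_mul_snd_le hβ hU1 hU2' (fun i => (hl i).le) hφD
  have h₂ := adjointMatrix_mul_fst_le hβ hU1 hU2' (fun i => (hl i).le) hφD
  set T := adjointMatrix (conjMap β U U') with hT
  have hG2 : derivMatrix U' (partialDeriv (fun t => β (ρ t)) θ) =
      Tᴴ * derivMatrix U (partialDeriv ρ θ) := by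
    ext c i
    have h := congrFun (adjointMatrix_conjTranspose_mulVec (conjMap β U U')
      (Uᴴ * partialDeriv ρ θ i * U)) c
    have e : U * (Uᴴ * partialDeriv ρ θ i * U) * Uᴴ = partialDeriv ρ θ i := by
      calc _ = (U * Uᴴ) * partialDeriv ρ θ i * (U * Uᴴ) := by simp only [Matrix.mul_assoc]
        _ = _ := by rw [hU2, Matrix.one_mul, Matrix.mul_one]
    rw [conjMap_apply, e, ← partialDeriv_map β hd] at h
    exact h.symm
  -- The derivative of `β ∘ ρ` lives on the support of `β (ρ θ)`, where the mean is positive.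
  have hsupp : ∀ i c d, (U'ᴴ * partialDeriv (fun t => β (ρ t)) θ i * U') c d ≠ 0 →
      mean f (hD'.1.eigenvalues c) (hD'.1.eigenvalues d) ≠ 0 := by
    intro i c d hcd
    have hz : ¬ ∀ a, T a (c, d) = 0 := by
      intro hz
      refine hcd ?_
      have := congrFun (congrFun hG2 (c, d)) i
      rw [Matrix.mul_apply] at this
      refine this.trans (Finset.sum_eq_zero fun a _ => ?_)
      rw [conjTranspose_apply, hz, star_zero, zero_mul]
    have hc : hD'.1.eigenvalues c ≠ 0 := fun h0 =>
      hz (eq_zero_of_conjTranspose_mul_diagonal_mul_le (k := (c, d))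
        (x := fun a : Fin n × Fin n => hD.1.eigenvalues a.1)
        (x' := fun a : Fin m × Fin m => hD'.1.eigenvalues a.1) (fun a => hl a.1) h₂ h0)
    have hd : hD'.1.eigenvalues d ≠ 0 := fun h0 =>
      hz (eq_zero_of_conjTranspose_mul_diagonal_mul_le (k := (c, d))
        (x := fun a : Fin n × Fin n => hD.1.eigenvalues a.2)
        (x' := fun a : Fin m × Fin m => hD'.1.eigenvalues a.2) (fun a => hl a.2) h₁ h0)
    exact (mean_pos hf.pos (lt_of_le_of_ne (hl' c) hc.symm) (lt_of_le_of_ne (hl' d) hd.symm)).ne'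
  rw [fisherMatrix_eq f (fun t => β (ρ t)) θ hD'.1 hA' hU' hsupp,
    fisherMatrix_eq f ρ θ hD.1 hA hU (fun _ a b _ => (mean_pos hf.pos (hl a) (hl b)).ne'), hG2,
    conjTranspose_mul, conjTranspose_conjTranspose]
  have h := conjTranspose_mul_mul_le (hf.inv_mean_le
    (x := fun a : Fin n × Fin n => hD.1.eigenvalues a.2) (y := fun a => hD.1.eigenvalues a.1)
    (x' := fun c : Fin m × Fin m => hD'.1.eigenvalues c.2) (y' := fun c => hD'.1.eigenvalues c.1)
    (fun a => hl a.2) (fun a => hl a.1) (fun c => hl' c.2) (fun c => hl' c.1) h₁ h₂)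
    (derivMatrix U (partialDeriv ρ θ))
  simpa only [Matrix.mul_assoc] using h
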